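/- Let $k\ge 2$ and $d\ge 1$ be integers and let $\mathcal H=(\mathbb C^d)^{\otimes k}$ with computational basis $|i_1,\dots,i_k\rangle$. A state is a positive semidefinite operator on $\mathcal H$ of unit trace, and $\|X\|_1=\operatorname{Tr}\sqrt{X^*X}$. For states $\rho,\sigma$ let $F(\rho,\sigma)=\|\sqrt\rho\sqrt\sigma\|_1^2$ be the fidelity. For a state $\rho$ and a positive semidefinite operator $\sigma$ let $D(\rho\|\sigma)=\operatorname{Tr}[\rho(\log_2\rho-\log_2\sigma)]$ if $\operatorname{supp}\rho\subseteq\operatorname{supp}\sigma$ and $D(\rho\|\sigma)=+\infty$ otherwise. For $p,q:\mathcal X\to[0,\infty)$ on a finite set $\mathcal X$, let $D(p\|q)=\sum_x p(x)\log_2\frac{p(x)}{q(x)}$ if $\operatorname{supp}p\subseteq\operatorname{supp}q$ and $+\infty$ otherwise, with terms $p(x)=0$ counted as $0$. Let $h_2(p)=-p\log_2p-(1-p)\log_2(1-p)$, with $0\log_20=0$. Let $\Phi^d=\frac1d\sum_{i,j=0}^{d-1}|i\rangle\langle j|^{\otimes k}$ be the $k$-party GHZ state. Let $m$ range over the unordered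 bipartitions of the $k$ parties into two nonempty blocks, and let $T_m$ be the partial transpose, in the computational basis, on one of the two blocks of $m$ (the trace norm of $T_m(X)$ does not depend on which). The genuine multipartite Rains entanglement of a state $\rho$ is $$R(\rho)=\inf\Bigl\{D\Bigl(\rho\Big\|\sum_m r_m\omega_m\Bigr)+\log_2\Bigl(\sum_m r_m\|T_m(\omega_m)\|_1\Bigr)\Bigr\},$$ where the infimum is over all probability distributions $(r_m)_m$ and all families $(\omega_m)_m$ of states on $\mathcal H$. Let $\mathcal T$ be the set of operators $\tau=\sum_m q_m\tau_m$ with real $q_m\ge 0$, positive semidefinite $\tau_m$, and $\sum_m q_m\|T_m(\tau_m)\|_1\le 1$. For every state $\rho$ on $\mathcal H$ whose fidelity $F=F(\Phi^d,\rho)$ satisfies $F\ge 1/d$, $$R(\rho)\;\ge\; D\bigl((F,1-F)\,\big\|\,(1/d,1-1/d)\bigr)\;\ge\; F\log_2 d-h_2(F).$$ Moreover, $\operatorname{Tr}[\Phi^d\sigma]\le \frac1d$ for every $\sigma\in\mathcal T$. -/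

import Mathlib

namespace GMRE

open Matrix
open scoped ComplexOrder

noncomputable section

section General

variable {n : Type*} [Fintype n] [DecidableEq n]

/-- Quantum states: positive semidefinite operators of unit trace. -/
def IsState (ρ : Matrix n n ℂ) : Prop :=
  ρ.PosSemidef ∧ ρ.trace = 1

/-- The trace norm `Tr |X|`, where `|X| = √(X* X)`. -/
def traceNorm (X : Matrix n n ℂ) : ℝ :=
  (cfc Real.sqrt (Xᴴ * X)).trace.re

/-- The fidelity `‖√ρ √σ‖₁²`. -/
def fidelity (ρ σ : Matrix n n ℂ) : ℝ :=
  traceNorm (cfc Real.sqrt ρ * cfc Real.sqrt σ) ^ 2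

/-- The support of an operator: the orthogonal complement of its kernel. -/
def support (A : Matrix n n ℂ) : Submodule ℂ (EuclideanSpace ℂ n) :=
  (LinearMap.ker (Matrix.toEuclideanLin A))ᗮ

open Classical in
/-- The quantum relative entropy in base 2. The logarithm of a positive semidefinite operator is
taken on its support and extended by `0` on its kernel (`Real.logb 2 0 = 0`). -/
def quantumRelEntropy (ρ σ : Matrix n n ℂ) : EReal :=
  if support ρ ≤ support σ then
    (((ρ * (cfc (Real.logb 2) ρ - cfc (Real.logb 2) σ)).trace.re : ℝ) : EReal)
  else ⊤

open Classical in
/-- The classical relative entropy in base 2 of nonnegative functions on a finite alphabet; the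
terms with `p x = 0` vanish. -/
def classicalRelEntropy {X : Type*} [Fintype X] (p q : X → ℝ) : EReal :=
  if Function.support p ⊆ Function.support q then
    ((∑ x, p x * Real.logb 2 (p x / q x) : ℝ) : EReal)
  else ⊤

/-- The binary entropy in base 2. -/
def binaryEntropy (p : ℝ) : ℝ :=
  -p * Real.logb 2 p - (1 - p) * Real.logb 2 (1 - p)

end General

/-- Operators on `(ℂ^d)^{⊗k}`, as matrices in the computational basis `|a₀, …, a_{k-1}⟩`. -/
abbrev Op (k d : ℕ) : Type := Matrix (Fin k → Fin d) (Fin k → Fin d) ℂ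

/-- The unordered bipartitions `{S, Sᶜ}` of the `k` parties into two nonempty blocks. Each is
represented exactly once, by the block that does not contain party `0`. -/
abbrev Bipartition (k : ℕ) : Type :=
  {S : Finset (Fin k) // S.Nonempty ∧ ∀ i ∈ S, (i : ℕ) ≠ 0}

/-- The partial transpose on the parties in `S`, in the computational basis: the row and column
indices of these parties are exchanged. (Taking the complement of `S` instead gives the full
transpose of the result, which has the same trace norm.) -/
def partialTranspose {k d : ℕ} (S : Finset (Fin k)) (X : Op k d) : Op k d :=
  Matrix.of fun a b => X (S.piecewise b a) (S.piecewise a b)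

/-- The GHZ state `(1/d) ∑ i j, |i⟩⟨j|^{⊗k}`. -/
def ghz (k d : ℕ) : Op k d :=
  (1 / (d : ℂ)) • ∑ i : Fin d, ∑ j : Fin d, Matrix.single (fun _ => i) (fun _ => j) 1

/-- The genuine multipartite Rains entanglement: the infimum of
`D(ρ‖σ) + log₂ (∑ m, r m * ‖T_m (ω m)‖₁)` over all decompositions `σ = ∑ m, r m • ω m`, where `m`
ranges over the bipartitions, `r` is a probability distribution and each `ω m` is a state. -/
def gmre {k d : ℕ} (ρ : Op k d) : EReal :=
  sInf {x : EReal | ∃ (r : Bipartition k → ℝ) (ω : Bipartition k → Op k d),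
    (∀ m, 0 ≤ r m) ∧ ∑ m, r m = 1 ∧ (∀ m, IsState (ω m)) ∧
    x = quantumRelEntropy ρ (∑ m, r m • ω m) +
      ((Real.logb 2 (∑ m, r m * traceNorm (partialTranspose m.1 (ω m))) : ℝ) : EReal)}

/-- The set `T` of operators `∑ m, q m • τ m` with `q m ≥ 0`, `τ m ≥ 0` and
`∑ m, q m * ‖T_m (τ m)‖₁ ≤ 1`, where `m` ranges over the bipartitions. -/
def setT (k d : ℕ) : Set (Op k d) :=
  {τ | ∃ (q : Bipartition k → ℝ) (t : Bipartition k → Op k d),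
    (∀ m, 0 ≤ q m) ∧ (∀ m, (t m).PosSemidef) ∧ τ = ∑ m, q m • t m ∧
    ∑ m, q m * traceNorm (partialTranspose m.1 (t m)) ≤ 1}

end

end GMRE

/-!
Measuring with `{Φ, 1 - Φ}`, where `Φ` is the GHZ projection, does not increase the relative
entropy. By Nussbaum and Szkoła the relative entropy of `ρ` and `σ` is that of two classical
distributions `p` and `q`, and so, up to the factor `log 2`, the limit of
`(∫ t in 0..T, ∑ p² / (q + t p)) - log T` as `T → ∞`. The integrand has a variational description
in terms of `ρ` and `σ`, in which the operator Jensen inequality shows that measurements do not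
increase it.

It remains to compare `(s, 1 - s)`, for `s = Tr[Φ σ]` and `σ = ∑ m, r m • ω m`, with
`(1/d, 1 - 1/d)`. Across a bipartition `m`, the partial transpose of `Φ` is `1/d` times a partial
permutation matrix, so that `Tr[Φ ω] ≤ ‖T_m ω‖₁ / d` by Hölder's inequality, and hence `s ≤ N / d`
with `N = ∑ m, r m * ‖T_m (ω m)‖₁`. As `F ≥ 1/d`, the mean under `(F, 1 - F)` of the likelihood
ratio of `(s, 1 - s)` to `(1/d, 1 - 1/d)` is then at most `N`, and by Jensen's inequality the
change of the second argument costs at most `log₂ N`.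
-/

namespace GMRE

open Matrix Filter Topology
open scoped ComplexOrder

section ClassicalRelEntropy

variable {X : Type*} [Fintype X] {p q q' : X → ℝ}

theorem classicalRelEntropy_of_support_subset (h : Function.support p ⊆ Function.support q) :
    classicalRelEntropy p q =
      (((∑ x, p x * Real.log (p x / q x)) / Real.log 2 : ℝ) : EReal) := by
  simp only [classicalRelEntropy, if_pos h, Real.logb, ← mul_div_assoc, Finset.sum_div]

theorem classicalRelEntropy_of_not_support_subset
    (h : ¬ Function.support p ⊆ Function.support q) : classicalRelEntropy p q = ⊤ :=
  if_neg h

theorem mul_log_div_le_of_pos {a b b' N : ℝ} (ha : 0 < a) (hb : 0 < b) (hb' : 0 < b')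
    (hN : 0 < N) :
    a * Real.log (a / b) ≤ a * Real.log (a / b') + a * Real.log N + (a * (b' / b) / N - a) := by
  have hlog : Real.log (b' / b / N) ≤ b' / b / N - 1 := Real.log_le_sub_one_of_pos (by positivity)
  have hsplit : Real.log (b' / b / N) = Real.log (a / b) - Real.log (a / b') - Real.log N := by
    rw [Real.log_div (div_pos hb' hb).ne' hN.ne', Real.log_div hb'.ne' hb.ne',
      Real.log_div ha.ne' hb.ne', Real.log_div ha.ne' hb'.ne']
    ring
  calc a * Real.log (a / b)
      = a * Real.log (a / b') + a * Real.log N + a * Real.log (b' / b / N) := by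
        rw [hsplit]; ring
    _ ≤ a * Real.log (a / b') + a * Real.log N + a * (b' / b / N - 1) := by gcongr
    _ = _ := by ring

theorem classicalRelEntropy_le_add_logb (hp : ∀ x, 0 ≤ p x) (hp1 : ∑ x, p x = 1)
    (hq : ∀ x, 0 ≤ q x) (hq' : ∀ x, 0 ≤ q' x)
    (hpq : Function.support p ⊆ Function.support q) {N : ℝ}
    (hN : ∑ x, p x * (q' x / q x) ≤ N) :
    classicalRelEntropy p q ≤ classicalRelEntropy p q' + (Real.logb 2 N : ℝ) := by
  by_cases hpq' : Function.support p ⊆ Function.support q'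
  swap
  · simp [classicalRelEntropy_of_not_support_subset hpq']
  have hpos : ∀ x, p x ≠ 0 → 0 < q x ∧ 0 < q' x := fun x hx =>
    ⟨(hq x).lt_of_ne' (hpq hx), (hq' x).lt_of_ne' (hpq' hx)⟩
  have hN0 : 0 < N := by
    obtain ⟨x, -, hx⟩ := Finset.exists_ne_zero_of_sum_ne_zero (hp1.trans_ne one_ne_zero)
    obtain ⟨hqx, hqx'⟩ := hpos x hx
    refine lt_of_lt_of_le ?_ hN
    exact Finset.sum_pos' (fun y _ => mul_nonneg (hp y) (div_nonneg (hq' y) (hq y)))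
      ⟨x, Finset.mem_univ x, mul_pos ((hp x).lt_of_ne' hx) (div_pos hqx' hqx)⟩
  have hterm : ∀ x, p x * Real.log (p x / q x) ≤
      p x * Real.log (p x / q' x) + p x * Real.log N + (p x * (q' x / q x) / N - p x) := by
    intro x
    by_cases hx : p x = 0
    · simp [hx]
    · exact mul_log_div_le_of_pos ((hp x).lt_of_ne' hx) (hpos x hx).1 (hpos x hx).2 hN0
  have hsum : ∑ x, p x * Real.log (p x / q x) ≤ ∑ x, p x * Real.log (p x / q' x) + Real.log N := by
    refine (Finset.sum_le_sum fun x _ => hterm x).trans ?_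
    rw [Finset.sum_add_distrib, Finset.sum_add_distrib, Finset.sum_sub_distrib, ← Finset.sum_mul,
      ← Finset.sum_div, hp1, one_mul]
    linarith [(div_le_one hN0).2 hN]
  rw [classicalRelEntropy_of_support_subset hpq, classicalRelEntropy_of_support_subset hpq',
    ← EReal.coe_add, EReal.coe_le_coe_iff, Real.logb, ← add_div]
  exact div_le_div_of_nonneg_right hsum (Real.log_nonneg one_le_two)

end ClassicalRelEntropy

section QuadraticDivergence

variable {X X' : Type*} [Fintype X] [Fintype X'] {p q : X → ℝ} {p' q' : X' → ℝ} {t : ℝ}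

/-- The `f`-divergences `∑ p² / (q + t p)`. They arise from the resolvents in the integral
representation of the logarithm, and integrating them over `t` recovers the relative entropy. -/
noncomputable def quadraticDivergence (p q : X → ℝ) (t : ℝ) : ℝ :=
  ∑ x, p x ^ 2 / (q x + t * p x)

/-- The primitive in `t` of `quadraticDivergence p q` that vanishes at `t = 0`, when
`p` and `q` are nonnegative and the support of `p` lies in that of `q`. -/
noncomputable def logDivergence (p q : X → ℝ) (t : ℝ) : ℝ :=
  ∑ x, p x * Real.log (1 + t * (p x / q x))

theorem logDivergence_zero : logDivergence p q 0 = 0 := by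
  simp [logDivergence]

theorem hasDerivAt_logDivergence (hp : ∀ x, 0 ≤ p x) (hq : ∀ x, 0 ≤ q x)
    (hpq : Function.support p ⊆ Function.support q) (ht : 0 ≤ t) :
    HasDerivAt (logDivergence p q) (quadraticDivergence p q t) t := by
  refine HasDerivAt.fun_sum fun x _ => ?_
  by_cases hx : p x = 0
  · simpa [hx] using hasDerivAt_const t (0 : ℝ)
  · have hpx : 0 < p x := (hp x).lt_of_ne' hx
    have hqx : 0 < q x := (hq x).lt_of_ne' (hpq hx)
    have hlin : HasDerivAt (fun t => 1 + t * (p x / q x)) (p x / q x) t := by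
      simpa using ((hasDerivAt_id t).mul_const (p x / q x)).const_add 1
    refine ((hlin.log (by positivity)).const_mul (p x)).congr_deriv ?_
    field_simp

theorem tendsto_logDivergence_sub_mul_log (hp : ∀ x, 0 ≤ p x) (hq : ∀ x, 0 ≤ q x)
    (hpq : Function.support p ⊆ Function.support q) :
    Tendsto (fun t => logDivergence p q t - (∑ x, p x) * Real.log t) atTop
      (𝓝 (∑ x, p x * Real.log (p x / q x))) := by
  simp only [logDivergence, Finset.sum_mul, ← Finset.sum_sub_distrib]
  refine tendsto_finsetSum _ fun x _ => ?_
  by_cases hx : p x = 0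
  · simp [hx]
  have hratio : 0 < p x / q x :=
    div_pos ((hp x).lt_of_ne' hx) ((hq x).lt_of_ne' (hpq hx))
  have hlim : Tendsto (fun t : ℝ => p x * Real.log (t⁻¹ + p x / q x)) atTop
      (𝓝 (p x * Real.log (p x / q x))) := by
    have h : Tendsto (fun t : ℝ => t⁻¹ + p x / q x) atTop (𝓝 (p x / q x)) := by
      simpa using tendsto_inv_atTop_zero.add_const (p x / q x)
    exact (h.log hratio.ne').const_mul _
  refine hlim.congr' ((eventually_gt_atTop 0).mono fun t ht => ?_)
  dsimp only
  rw [← mul_sub, ← Real.log_div (by positivity) ht.ne', add_div, mul_div_cancel_left₀ _ ht.ne',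
    one_div]

theorem logDivergence_le_of_quadraticDivergence_le
    (hp : ∀ x, 0 ≤ p x) (hq : ∀ x, 0 ≤ q x) (hpq : Function.support p ⊆ Function.support q)
    (hp' : ∀ x, 0 ≤ p' x) (hq' : ∀ x, 0 ≤ q' x)
    (hpq' : Function.support p' ⊆ Function.support q')
    (h : ∀ t, 0 < t → quadraticDivergence p' q' t ≤ quadraticDivergence p q t) (ht : 0 ≤ t) :
    logDivergence p' q' t ≤ logDivergence p q t := by
  have hderiv : ∀ s, 0 ≤ s → HasDerivAt (logDivergence p q - logDivergence p' q')
      (quadraticDivergence p q s - quadraticDivergence p' q' s) s := fun s hs =>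
    (hasDerivAt_logDivergence hp hq hpq hs).sub (hasDerivAt_logDivergence hp' hq' hpq' hs)
  have hmono : MonotoneOn (logDivergence p q - logDivergence p' q') (Set.Ici 0) := by
    refine monotoneOn_of_hasDerivWithinAt_nonneg (convex_Ici 0)
      (fun s hs => (hderiv s hs).continuousAt.continuousWithinAt)
      (fun s hs => (hderiv s (interior_subset hs)).hasDerivWithinAt) fun s hs => ?_
    rw [interior_Ici] at hs
    exact sub_nonneg.2 (h s hs)
  have h0t := hmono Set.self_mem_Ici ht ht
  simpa only [Pi.sub_apply, logDivergence_zero, sub_zero, sub_nonneg] using h0t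

theorem support_subset_of_quadraticDivergence_le
    (hp : ∀ x, 0 ≤ p x) (hq : ∀ x, 0 ≤ q x) (hpq : Function.support p ⊆ Function.support q)
    (hp' : ∀ x, 0 ≤ p' x) (hq' : ∀ x, 0 ≤ q' x)
    (h : ∀ t, 0 < t → quadraticDivergence p' q' t ≤ quadraticDivergence p q t) :
    Function.support p' ⊆ Function.support q' := by
  intro x hx hqx
  have hpx : 0 < p' x := (hp' x).lt_of_ne' hx
  set K := ∑ y, p y ^ 2 / q y
  have hK0 : 0 ≤ K := Finset.sum_nonneg fun y _ => div_nonneg (sq_nonneg _) (hq y)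
  have hbound : ∀ t, 0 < t → p' x / t ≤ K := by
    intro t ht
    calc p' x / t = p' x ^ 2 / (q' x + t * p' x) := by rw [hqx]; field_simp; ring
      _ ≤ quadraticDivergence p' q' t :=
        Finset.single_le_sum (f := fun y => p' y ^ 2 / (q' y + t * p' y)) (fun y _ =>
          div_nonneg (sq_nonneg _) (add_nonneg (hq' y) (mul_nonneg ht.le (hp' y))))
          (Finset.mem_univ x)
      _ ≤ quadraticDivergence p q t := h t ht
      _ ≤ K := Finset.sum_le_sum fun y _ => by
        by_cases hy : p y = 0
        · simp [hy]
        · exact div_le_div_of_nonneg_left (sq_nonneg _) ((hq y).lt_of_ne' (hpq hy))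
            (le_add_of_nonneg_right (mul_nonneg ht.le (hp y)))
  have := hbound (p' x / (K + 1)) (by positivity)
  rw [div_div_cancel₀ hpx.ne'] at this
  linarith

theorem classicalRelEntropy_le_of_quadraticDivergence_le
    (hp : ∀ x, 0 ≤ p x) (hq : ∀ x, 0 ≤ q x) (hp' : ∀ x, 0 ≤ p' x) (hq' : ∀ x, 0 ≤ q' x)
    (hsum : ∑ x, p' x = ∑ x, p x)
    (h : ∀ t, 0 < t → quadraticDivergence p' q' t ≤ quadraticDivergence p q t) :
    classicalRelEntropy p' q' ≤ classicalRelEntropy p q := by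
  by_cases hpq : Function.support p ⊆ Function.support q
  swap
  · exact (classicalRelEntropy_of_not_support_subset hpq).symm ▸ le_top
  have hpq' := support_subset_of_quadraticDivergence_le hp hq hpq hp' hq' h
  rw [classicalRelEntropy_of_support_subset hpq, classicalRelEntropy_of_support_subset hpq',
    EReal.coe_le_coe_iff]
  refine div_le_div_of_nonneg_right ?_ (Real.log_nonneg one_le_two)
  refine le_of_tendsto_of_tendsto (tendsto_logDivergence_sub_mul_log hp' hq' hpq')
    (tendsto_logDivergence_sub_mul_log hp hq hpq) ((eventually_ge_atTop 0).mono fun t ht => ?_)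
  dsimp only
  rw [hsum]
  exact sub_le_sub_right
    (logDivergence_le_of_quadraticDivergence_le hp hq hpq hp' hq' hpq' h ht) _

end QuadraticDivergence

section Spectral

variable {n : Type*} [Fintype n] [DecidableEq n] {A B : Matrix n n ℂ}

/-- The matrix `⟨aᵢ, M bⱼ⟩` of the operator `M` between the eigenbases of `A` and of `B`. -/
noncomputable def eigenbasisMatrix (hA : A.IsHermitian) (hB : B.IsHermitian)
    (M : Matrix n n ℂ) : Matrix n n ℂ :=
  star (hA.eigenvectorUnitary : Matrix n n ℂ) * M * hB.eigenvectorUnitary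

theorem trace_cfc_mul_mul_cfc_mul_conjTranspose (hA : A.IsHermitian) (hB : B.IsHermitian)
    (f g : ℝ → ℝ) (M N : Matrix n n ℂ) :
    (cfc f A * M * cfc g B * Nᴴ).trace =
      ∑ i, ∑ j, ((f (hA.eigenvalues i) * g (hB.eigenvalues j) : ℝ) : ℂ) *
        (eigenbasisMatrix hA hB M i j * star (eigenbasisMatrix hA hB N i j)) := by
  set U := (hA.eigenvectorUnitary : Matrix n n ℂ)
  set V := (hB.eigenvectorUnitary : Matrix n n ℂ)
  have hf : cfc f A = U * diagonal (fun i => (f (hA.eigenvalues i) : ℂ)) * Uᴴ := hA.cfc_eq f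
  have hg : cfc g B = V * diagonal (fun j => (g (hB.eigenvalues j) : ℂ)) * Vᴴ := hB.cfc_eq g
  have hN : (eigenbasisMatrix hA hB N)ᴴ = Vᴴ * Nᴴ * U := by
    simp [eigenbasisMatrix, U, V, star_eq_conjTranspose, Matrix.mul_assoc]
  calc (cfc f A * M * cfc g B * Nᴴ).trace
      = (diagonal (fun i => (f (hA.eigenvalues i) : ℂ)) * eigenbasisMatrix hA hB M *
          diagonal (fun j => (g (hB.eigenvalues j) : ℂ)) * (eigenbasisMatrix hA hB N)ᴴ).trace := by
        rw [hf, hg, hN, eigenbasisMatrix, star_eq_conjTranspose]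
        simp only [Matrix.mul_assoc]
        rw [trace_mul_comm U]
        simp only [Matrix.mul_assoc, U, V]
    _ = _ := by
        simp only [trace, diag_apply, mul_apply (N := _ᴴ), mul_diagonal, diagonal_mul,
          conjTranspose_apply, Complex.ofReal_mul]
        refine Finset.sum_congr rfl fun i _ => Finset.sum_congr rfl fun j _ => ?_
        ring

theorem trace_cfc_mul_cfc (hA : A.IsHermitian) (hB : B.IsHermitian) (f g : ℝ → ℝ) :
    (cfc f A * cfc g B).trace.re =
      ∑ i, ∑ j, f (hA.eigenvalues i) * g (hB.eigenvalues j) *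
        ‖eigenbasisMatrix hA hB 1 i j‖ ^ 2 := by
  have h := trace_cfc_mul_mul_cfc_mul_conjTranspose hA hB f g 1 1
  rw [mul_one, conjTranspose_one, mul_one] at h
  simp only [h, Complex.re_sum, Complex.star_def, Complex.mul_conj, ← Complex.ofReal_mul,
    Complex.ofReal_re, Complex.normSq_eq_norm_sq]

theorem support_le_support_iff_forall_mulVec :
    support A ≤ support B ↔ ∀ v, B *ᵥ v = 0 → A *ᵥ v = 0 := by
  rw [support, support, Submodule.orthogonal_le_orthogonal_iff]
  constructor
  · intro h v hv
    have := @h (WithLp.toLp 2 v) (by simpa using hv)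
    simpa using this
  · intro h v hv
    have := h v.ofLp (by simpa [Matrix.toLpLin_apply] using hv)
    simpa [Matrix.toLpLin_apply] using this

theorem eigenbasisMatrix_self_one (hA : A.IsHermitian) : eigenbasisMatrix hA hA 1 = 1 := by
  rw [eigenbasisMatrix, mul_one, Unitary.coe_star_mul_self]

theorem mulVec_eigenvectorUnitary_mulVec_eq_zero_iff (hA : A.IsHermitian) (hB : B.IsHermitian)
    (w : n → ℂ) : A *ᵥ (hB.eigenvectorUnitary : Matrix n n ℂ) *ᵥ w = 0 ↔
      ∀ i, (hA.eigenvalues i : ℂ) * (eigenbasisMatrix hA hB 1 *ᵥ w) i = 0 := by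
  set U := (hA.eigenvectorUnitary : Matrix n n ℂ) with hU
  have hUinj : Function.Injective U.mulVec := by
    refine Function.LeftInverse.injective (g := (star U).mulVec) fun v => ?_
    rw [mulVec_mulVec, hU, Unitary.coe_star_mul_self, one_mulVec]
  have hspec : A = U * diagonal (fun i => (hA.eigenvalues i : ℂ)) * star U := hA.spectral_theorem
  have hfactor : A *ᵥ (hB.eigenvectorUnitary : Matrix n n ℂ) *ᵥ w =
      U *ᵥ diagonal (fun i => (hA.eigenvalues i : ℂ)) *ᵥ eigenbasisMatrix hA hB 1 *ᵥ w := by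
    conv_lhs => rw [hspec]
    simp only [eigenbasisMatrix, mulVec_mulVec, Matrix.mul_assoc, Matrix.one_mul, hU]
  rw [hfactor, ← mulVec_zero U, hUinj.eq_iff, funext_iff]
  simp only [mulVec_diagonal, Pi.zero_apply]

theorem support_le_support_iff_eigenvalues (hA : A.IsHermitian) (hB : B.IsHermitian) :
    support A ≤ support B ↔ ∀ i j, hB.eigenvalues j = 0 →
      hA.eigenvalues i * eigenbasisMatrix hA hB 1 i j = 0 := by
  set V := (hB.eigenvectorUnitary : Matrix n n ℂ) with hV
  have hcoord : (∀ v, B *ᵥ v = 0 → A *ᵥ v = 0) ↔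
      ∀ w, B *ᵥ V *ᵥ w = 0 → A *ᵥ V *ᵥ w = 0 := by
    refine ⟨fun h w => h _, fun h v => ?_⟩
    have hv : V *ᵥ star V *ᵥ v = v := by
      rw [mulVec_mulVec, Unitary.mul_star_self_of_mem hB.eigenvectorUnitary.2, one_mulVec]
    simpa only [hv] using h (star V *ᵥ v)
  rw [support_le_support_iff_forall_mulVec, hcoord]
  simp only [hV, mulVec_eigenvectorUnitary_mulVec_eq_zero_iff hA hB,
    mulVec_eigenvectorUnitary_mulVec_eq_zero_iff hB hB, eigenbasisMatrix_self_one, one_mulVec]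
  constructor
  · intro h i j hj
    have hw := h (Pi.single j 1) fun k => by
      by_cases hk : k = j <;> simp [hk, hj]
    simpa only [mulVec_single_one, col_apply] using hw i
  · intro h w hw i
    rw [mulVec, dotProduct, Finset.mul_sum]
    refine Finset.sum_eq_zero fun j _ => ?_
    rw [← mul_assoc]
    rcases mul_eq_zero.1 (hw j) with hj | hj
    · rw [h i j (Complex.ofReal_eq_zero.1 hj), zero_mul]
    · rw [hj, mul_zero]

end Spectral

section NussbaumSzkola

variable {n : Type*} [Fintype n] [DecidableEq n] {ρ σ : Matrix n n ℂ}

/-- The first Nussbaum–Szkoła distribution `pᵢ |⟨aᵢ, bⱼ⟩|²` of a pair of Hermitian operators with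
eigenvalues `pᵢ`, `qⱼ` and eigenbases `aᵢ`, `bⱼ`. -/
noncomputable def nussbaumSzkolaLeft (hρ : ρ.IsHermitian) (hσ : σ.IsHermitian) (x : n × n) : ℝ :=
  hρ.eigenvalues x.1 * ‖eigenbasisMatrix hρ hσ 1 x.1 x.2‖ ^ 2

/-- The second Nussbaum–Szkoła distribution `qⱼ |⟨aᵢ, bⱼ⟩|²`. Relative entropies of a pair of
operators are those of its pair of Nussbaum–Szkoła distributions. -/
noncomputable def nussbaumSzkolaRight (hρ : ρ.IsHermitian) (hσ : σ.IsHermitian) (x : n × n) : ℝ :=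
  hσ.eigenvalues x.2 * ‖eigenbasisMatrix hρ hσ 1 x.1 x.2‖ ^ 2

theorem sum_nussbaumSzkolaLeft (hρ : ρ.IsHermitian) (hσ : σ.IsHermitian) :
    ∑ x, nussbaumSzkolaLeft hρ hσ x = ρ.trace.re := by
  have h := trace_cfc_mul_cfc hρ hσ (fun x => x) fun _ => 1
  rw [cfc_id' ℝ ρ hρ.isSelfAdjoint, cfc_const_one ℝ σ hσ.isSelfAdjoint, mul_one] at h
  simp only [h, nussbaumSzkolaLeft, Fintype.sum_prod_type, mul_one]

theorem support_nussbaumSzkola_subset_iff (hρ : ρ.IsHermitian) (hσ : σ.IsHermitian) :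
    Function.support (nussbaumSzkolaLeft hρ hσ) ⊆ Function.support (nussbaumSzkolaRight hρ hσ) ↔
      support ρ ≤ support σ := by
  simp only [support_le_support_iff_eigenvalues hρ hσ, Set.subset_def, Function.mem_support,
    nussbaumSzkolaLeft, nussbaumSzkolaRight, Prod.forall, ne_eq, mul_eq_zero, not_or,
    pow_eq_zero_iff two_ne_zero, norm_eq_zero, Complex.ofReal_eq_zero]
  exact forall₂_congr fun i j => by tauto

theorem classicalRelEntropy_nussbaumSzkola (hρ : ρ.IsHermitian) (hσ : σ.IsHermitian) :
    classicalRelEntropy (nussbaumSzkolaLeft hρ hσ) (nussbaumSzkolaRight hρ hσ) =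
      quantumRelEntropy ρ σ := by
  by_cases hsupp : support ρ ≤ support σ
  swap
  · rw [quantumRelEntropy, if_neg hsupp, classicalRelEntropy, if_neg]
    rwa [support_nussbaumSzkola_subset_iff]
  have hsub := (support_nussbaumSzkola_subset_iff hρ hσ).2 hsupp
  rw [quantumRelEntropy, if_pos hsupp, classicalRelEntropy, if_pos hsub, EReal.coe_eq_coe_iff]
  have hself : (ρ * cfc (Real.logb 2) ρ).trace.re = ∑ i, ∑ j, hρ.eigenvalues i *
      Real.logb 2 (hρ.eigenvalues i) * ‖eigenbasisMatrix hρ hσ 1 i j‖ ^ 2 := by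
    have h := trace_cfc_mul_cfc hρ hσ (fun x => x * Real.logb 2 x) fun _ => 1
    rw [cfc_mul _ _ ρ (finite_real_spectrum.continuousOn _) (finite_real_spectrum.continuousOn _),
      cfc_id' ℝ ρ hρ.isSelfAdjoint, cfc_const_one ℝ σ hσ.isSelfAdjoint, mul_one] at h
    simpa only [mul_one] using h
  have hcross := trace_cfc_mul_cfc hρ hσ (fun x => x) (Real.logb 2)
  rw [cfc_id' ℝ ρ hρ.isSelfAdjoint] at hcross
  rw [mul_sub, trace_sub, Complex.sub_re, hself, hcross, Fintype.sum_prod_type]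
  simp only [← Finset.sum_sub_distrib]
  refine Finset.sum_congr rfl fun i _ => Finset.sum_congr rfl fun j _ => ?_
  by_cases hij : nussbaumSzkolaLeft hρ hσ (i, j) = 0
  · rw [hij, zero_mul]
    rcases mul_eq_zero.1 hij with h | h <;> simp only at h <;> simp [h]
  · have hij' := hsub hij
    obtain ⟨hp, hc⟩ := mul_ne_zero_iff.1 hij
    obtain ⟨hq, -⟩ := mul_ne_zero_iff.1 hij'
    rw [nussbaumSzkolaLeft, nussbaumSzkolaRight, mul_div_mul_right _ _ hc, Real.logb_div hp hq]
    ring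

end NussbaumSzkola

section Measurement

theorem two_mul_re_sub_le_div {p q : ℝ} (hp : 0 ≤ p) (hq : 0 ≤ q) {t : ℝ} (ht : 0 < t) (c z : ℂ) :
    2 * (p * (c * star z).re) - (q + t * p) * ‖z‖ ^ 2 ≤
      (p * ‖c‖ ^ 2) ^ 2 / (q * ‖c‖ ^ 2 + t * (p * ‖c‖ ^ 2)) := by
  have hre : (c * star z).re ≤ ‖c‖ * ‖z‖ := by
    simpa only [norm_mul, norm_star] using Complex.re_le_norm (c * star z)
  rcases hp.eq_or_lt with rfl | hp
  · simpa using mul_nonneg hq (sq_nonneg ‖z‖)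
  rcases eq_or_ne c 0 with rfl | hc
  · simpa using mul_nonneg (by positivity : 0 ≤ q + t * p) (sq_nonneg ‖z‖)
  have hD : 0 < q + t * p := by positivity
  have hquot : (p * ‖c‖ ^ 2) ^ 2 / (q * ‖c‖ ^ 2 + t * (p * ‖c‖ ^ 2)) =
      (p * ‖c‖) ^ 2 / (q + t * p) := by
    have := norm_ne_zero_iff.2 hc
    field_simp
  rw [hquot, le_div_iff₀ hD]
  nlinarith [sq_nonneg (p * ‖c‖ - (q + t * p) * ‖z‖),
    mul_le_mul_of_nonneg_left hre (mul_pos hp hD).le]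

theorem isHermitian_sum_smul {n ι : Type*} [Fintype ι] {E : ι → Matrix n n ℂ}
    (hE : ∀ x, (E x).IsHermitian) (a : ι → ℝ) : (∑ x, a x • E x).IsHermitian :=
  isSelfAdjoint_sum _ fun x _ => (hE x).smul (.all (a x))

theorem re_trace_mul_nonneg {n : Type*} [Fintype n] {A B : Matrix n n ℂ}
    (hA : A.PosSemidef) (hB : B.PosSemidef) : 0 ≤ (A * B).trace.re := by
  classical
  have h := trace_cfc_mul_cfc hA.1 hB.1 (fun x => x) fun x => x
  rw [cfc_id' ℝ A hA.1.isSelfAdjoint, cfc_id' ℝ B hB.1.isSelfAdjoint] at h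
  rw [h]
  exact Finset.sum_nonneg fun i _ => Finset.sum_nonneg fun j _ => mul_nonneg
    (mul_nonneg (hA.eigenvalues_nonneg i) (hB.eigenvalues_nonneg j)) (sq_nonneg _)

variable {n ι : Type*} [Fintype n] [DecidableEq n] [Fintype ι] {ρ σ Y : Matrix n n ℂ}
  {E : ι → Matrix n n ℂ} {t : ℝ}

theorem two_mul_trace_sub_le_quadraticDivergence (hρ : ρ.PosSemidef) (hσ : σ.PosSemidef)
    (hY : Y.IsHermitian) (ht : 0 < t) :
    2 * (Y * ρ).trace.re - (Y * Y * (σ + t • ρ)).trace.re ≤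
      quadraticDivergence (nussbaumSzkolaLeft hρ.1 hσ.1) (nussbaumSzkolaRight hρ.1 hσ.1) t := by
  have hρ' : cfc (fun x => x) ρ = ρ := cfc_id' ℝ ρ hρ.1.isSelfAdjoint
  have hσ' : cfc (fun x => x) σ = σ := cfc_id' ℝ σ hσ.1.isSelfAdjoint
  have hρ1 : cfc (fun _ : ℝ => (1 : ℝ)) ρ = 1 := cfc_const_one ℝ ρ hρ.1.isSelfAdjoint
  have hσ1 : cfc (fun _ : ℝ => (1 : ℝ)) σ = 1 := cfc_const_one ℝ σ hσ.1.isSelfAdjoint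
  have hlin := trace_cfc_mul_mul_cfc_mul_conjTranspose hρ.1 hσ.1 (fun x => x) (fun _ => 1) 1 Y
  have hσY := trace_cfc_mul_mul_cfc_mul_conjTranspose hρ.1 hσ.1 (fun _ => 1) (fun x => x) Y Y
  have hρY := trace_cfc_mul_mul_cfc_mul_conjTranspose hρ.1 hσ.1 (fun x => x) (fun _ => 1) Y Y
  rw [hρ', hσ1, hY.eq, mul_one, mul_one, trace_mul_comm] at hlin
  rw [hρ1, hσ', hY.eq, one_mul, trace_mul_comm, ← mul_assoc] at hσY
  rw [hρ', hσ1, hY.eq, mul_one, mul_assoc, trace_mul_comm] at hρY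
  rw [mul_add, mul_smul_comm, trace_add, trace_smul, hlin, hσY, hρY, quadraticDivergence,
    Fintype.sum_prod_type]
  simp only [Complex.add_re, Complex.re_sum, Complex.smul_re, smul_eq_mul, Complex.re_ofReal_mul,
    Finset.mul_sum, ← Finset.sum_add_distrib, ← Finset.sum_sub_distrib]
  refine Finset.sum_le_sum fun i _ => Finset.sum_le_sum fun j _ => ?_
  refine le_trans (le_of_eq ?_) (two_mul_re_sub_le_div (hρ.eigenvalues_nonneg i)
    (hσ.eigenvalues_nonneg j) ht (eigenbasisMatrix hρ.1 hσ.1 1 i j)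
    (eigenbasisMatrix hρ.1 hσ.1 Y i j))
  simp only [Complex.star_def, Complex.mul_conj, Complex.ofReal_re, Complex.normSq_eq_norm_sq]
  ring

/-- A positive operator-valued measure with finitely many outcomes: the effects are positive
semidefinite operators which add up to the identity. -/
structure IsPOVM (E : ι → Matrix n n ℂ) : Prop where
  posSemidef : ∀ x, (E x).PosSemidef
  sum_eq_one : ∑ x, E x = 1

theorem IsPOVM.posSemidef_sum_sq_smul_sub (hE : IsPOVM E) (a : ι → ℝ) :
    (∑ x, a x ^ 2 • E x - (∑ x, a x • E x) * ∑ x, a x • E x).PosSemidef := by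
  set Y := ∑ x, a x • E x with hY
  have hYH : Y.IsHermitian := isHermitian_sum_smul (fun x => (hE.posSemidef x).1) a
  have hvar : ∑ x, a x ^ 2 • E x - Y * Y =
      ∑ x, (a x • (1 : Matrix n n ℂ) - Y) * E x * (a x • (1 : Matrix n n ℂ) - Y)ᴴ := by
    have hterm : ∀ x, (a x • (1 : Matrix n n ℂ) - Y) * E x * (a x • (1 : Matrix n n ℂ) - Y)ᴴ =
        a x ^ 2 • E x - (a x • E x) * Y - Y * (a x • E x) + Y * E x * Y := fun x => by
      rw [conjTranspose_sub, conjTranspose_smul, conjTranspose_one, hYH.eq, star_trivial]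
      simp only [sub_mul, mul_sub, smul_mul_assoc, mul_smul_comm, one_mul, mul_one, smul_sub,
        smul_smul, sq]
      abel
    simp only [hterm, Finset.sum_add_distrib, Finset.sum_sub_distrib, ← Finset.sum_mul,
      ← Finset.mul_sum, ← hY, hE.sum_eq_one, mul_one]
    abel
  rw [hvar]
  exact posSemidef_sum _ fun x _ => (hE.posSemidef x).mul_mul_conjTranspose_same _

/-- The optimal test operator for the measured distributions is diagonal in the effects, and the
operator Jensen inequality makes it a test operator for the states. -/
theorem IsPOVM.quadraticDivergence_le (hE : IsPOVM E) (hρ : ρ.PosSemidef) (hσ : σ.PosSemidef)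
    (ht : 0 < t) :
    quadraticDivergence (fun x => (E x * ρ).trace.re) (fun x => (E x * σ).trace.re) t ≤
      quadraticDivergence (nussbaumSzkolaLeft hρ.1 hσ.1) (nussbaumSzkolaRight hρ.1 hσ.1) t := by
  set p := fun x => (E x * ρ).trace.re
  set q := fun x => (E x * σ).trace.re
  set a := fun x => p x / (q x + t * p x)
  set Y := ∑ x, a x • E x
  have hJensen : (Y * Y * (σ + t • ρ)).trace.re ≤
      ((∑ x, a x ^ 2 • E x) * (σ + t • ρ)).trace.re := by
    have h := re_trace_mul_nonneg (hE.posSemidef_sum_sq_smul_sub a) (hσ.add (hρ.smul ht.le))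
    rwa [sub_mul, trace_sub, Complex.sub_re, sub_nonneg] at h
  refine le_trans (le_of_eq ?_) ((sub_le_sub_left hJensen _).trans
    (two_mul_trace_sub_le_quadraticDivergence hρ hσ
      (isHermitian_sum_smul (fun x => (hE.posSemidef x).1) a) ht))
  have hlin : (Y * ρ).trace.re = ∑ x, a x * p x := by
    simp only [Y, p, Finset.sum_mul, trace_sum, Complex.re_sum, smul_mul_assoc, trace_smul,
      Complex.smul_re, smul_eq_mul]
  have hquad : ((∑ x, a x ^ 2 • E x) * (σ + t • ρ)).trace.re =
      ∑ x, a x ^ 2 * (q x + t * p x) := by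
    simp only [p, q, Finset.sum_mul, trace_sum, Complex.re_sum, smul_mul_assoc, mul_add,
      mul_smul_comm, trace_smul, trace_add, Complex.smul_re, Complex.add_re, smul_eq_mul,
      Finset.sum_add_distrib, Finset.mul_sum, mul_left_comm t]
  rw [hlin, hquad, quadraticDivergence, Finset.mul_sum, ← Finset.sum_sub_distrib]
  refine Finset.sum_congr rfl fun x _ => ?_
  rcases eq_or_ne (q x + t * p x) 0 with hx | _
  · simp [a, hx]
  · simp only [a]
    field_simp
    ring

theorem IsPOVM.classicalRelEntropy_le (hE : IsPOVM E) (hρ : ρ.PosSemidef) (hσ : σ.PosSemidef) :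
    classicalRelEntropy (fun x => (E x * ρ).trace.re) (fun x => (E x * σ).trace.re) ≤
      quantumRelEntropy ρ σ := by
  have hmeas : ∀ {τ : Matrix n n ℂ}, τ.PosSemidef → ∀ x, 0 ≤ (E x * τ).trace.re := fun hτ x =>
    re_trace_mul_nonneg (hE.posSemidef x) hτ
  rw [← classicalRelEntropy_nussbaumSzkola hρ.1 hσ.1]
  refine classicalRelEntropy_le_of_quadraticDivergence_le
    (fun x => mul_nonneg (hρ.eigenvalues_nonneg _) (sq_nonneg _))
    (fun x => mul_nonneg (hσ.eigenvalues_nonneg _) (sq_nonneg _)) (hmeas hρ) (hmeas hσ) ?_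
    fun t ht => hE.quadraticDivergence_le hρ hσ ht
  rw [sum_nussbaumSzkolaLeft, ← Complex.re_sum, ← trace_sum, ← Finset.sum_mul, hE.sum_eq_one,
    one_mul]

end Measurement

section TraceNorm

theorem star_dotProduct_self_eq_norm_sq {n : Type*} [Fintype n] (u : n → ℂ) :
    star u ⬝ᵥ u = ((‖WithLp.toLp 2 u‖ ^ 2 : ℝ) : ℂ) := by
  rw [dotProduct_comm, ← EuclideanSpace.inner_toLp_toLp, inner_self_eq_norm_sq_to_K]
  norm_cast

variable {n : Type*} [Fintype n] [DecidableEq n]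

theorem traceNorm_eq_sum_norm_mulVec (X : Matrix n n ℂ) :
    traceNorm X = ∑ i, ‖WithLp.toLp 2
      (X *ᵥ (isHermitian_conjTranspose_mul_self X).eigenvectorBasis i)‖ := by
  set h := isHermitian_conjTranspose_mul_self X
  have htrace := trace_cfc_mul_cfc h h Real.sqrt fun _ => 1
  rw [cfc_const_one ℝ _ h.isSelfAdjoint, mul_one] at htrace
  rw [traceNorm, htrace]
  refine Finset.sum_congr rfl fun i _ => ?_
  have hnorm : ‖WithLp.toLp 2 (X *ᵥ h.eigenvectorBasis i)‖ ^ 2 = h.eigenvalues i := by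
    rw [h.eigenvalues_eq i, ← mulVec_mulVec, dotProduct_mulVec, ← star_mulVec,
      star_dotProduct_self_eq_norm_sq]
    exact (Complex.ofReal_re _).symm
  rw [← hnorm, Real.sqrt_sq (norm_nonneg _), Finset.sum_eq_single i]
  · simp [eigenbasisMatrix_self_one]
  · intro j _ hj
    simp [eigenbasisMatrix_self_one, hj.symm]
  · simp

open scoped Matrix.Norms.L2Operator

theorem norm_trace_mul_le (V X : Matrix n n ℂ) : ‖(V * X).trace‖ ≤ ‖V‖ * traceNorm X := by
  set b := (isHermitian_conjTranspose_mul_self X).eigenvectorBasis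
  have htrace : (V * X).trace = ∑ i, inner ℂ (b i) (WithLp.toLp 2 (V *ᵥ X *ᵥ b i)) := by
    rw [← Matrix.trace_toLin_eq (V * X) (EuclideanSpace.basisFun n ℂ).toBasis,
      ← toEuclideanLin_eq_toLin_orthonormal, LinearMap.trace_eq_sum_inner _ b]
    simp only [toLpLin_apply, mulVec_mulVec]
  rw [htrace, traceNorm_eq_sum_norm_mulVec, Finset.mul_sum]
  refine (norm_sum_le _ _).trans (Finset.sum_le_sum fun i _ => ?_)
  calc ‖inner ℂ (b i) (WithLp.toLp 2 (V *ᵥ X *ᵥ b i))‖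
      ≤ ‖b i‖ * ‖WithLp.toLp 2 (V *ᵥ X *ᵥ b i)‖ := norm_inner_le_norm _ _
    _ ≤ ‖V‖ * ‖WithLp.toLp 2 (X *ᵥ b i)‖ := by
      rw [b.norm_eq_one, one_mul]
      exact l2_opNorm_mulVec V (WithLp.toLp 2 (X *ᵥ b i))

theorem norm_trace_le_traceNorm (X : Matrix n n ℂ) : ‖X.trace‖ ≤ traceNorm X := by
  cases isEmpty_or_nonempty n
  · simp [traceNorm_eq_sum_norm_mulVec, trace]
  · simpa [CStarRing.norm_one] using norm_trace_mul_le 1 X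

theorem cfc_sqrt_of_mul_self_eq_smul {A : Matrix n n ℂ} (hA : A.IsHermitian) {c : ℝ} (hc : 0 ≤ c)
    (h : A * A = c • A) : cfc Real.sqrt A = (√c)⁻¹ • A := by
  have hsa : IsSelfAdjoint A := hA.isSelfAdjoint
  have hmul : cfc (fun x : ℝ => x * x) A = cfc (fun x : ℝ => c * x) A := by
    rw [cfc_mul (fun x : ℝ => x) (fun x : ℝ => x) A, cfc_const_mul_id c A, cfc_id' ℝ A, h]
  have hspec := (cfc_eq_cfc_iff_eqOn hsa (by fun_prop) (by fun_prop)).1 hmul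
  rw [← cfc_const_mul_id (√c)⁻¹ A]
  refine cfc_congr fun x hx => ?_
  rcases mul_eq_mul_right_iff.1 (hspec hx) with rfl | rfl
  · rw [← div_eq_inv_mul, Real.div_sqrt]
  · simp

theorem traceNorm_vecMulVec_star (u v : n → ℂ) :
    traceNorm (vecMulVec u (star v)) = ‖WithLp.toLp 2 u‖ * ‖WithLp.toLp 2 v‖ := by
  set c := ‖WithLp.toLp 2 u‖ * ‖WithLp.toLp 2 v‖ with hc
  have hc0 : 0 ≤ c := by positivity
  set A := (vecMulVec u (star v))ᴴ * vecMulVec u (star v)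
  have hA : A = ‖WithLp.toLp 2 u‖ ^ 2 • vecMulVec v (star v) := by
    simp only [A, conjTranspose_vecMulVec, vecMulVec_mul_vecMulVec, star_star,
      star_dotProduct_self_eq_norm_sq, Complex.coe_smul, vecMulVec_smul]
  have hAA : A * A = c ^ 2 • A := by
    simp only [hA, smul_mul_assoc, mul_smul_comm, vecMulVec_mul_vecMulVec,
      star_dotProduct_self_eq_norm_sq, Complex.coe_smul, vecMulVec_smul, smul_smul, hc]
    ring_nf
  have htrace : A.trace.re = c ^ 2 := by
    rw [hA, trace_smul, trace_vecMulVec, dotProduct_comm, star_dotProduct_self_eq_norm_sq,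
      Complex.smul_re, Complex.ofReal_re, smul_eq_mul, hc, mul_pow]
  rw [traceNorm,
    cfc_sqrt_of_mul_self_eq_smul (isHermitian_conjTranspose_mul_self _) (sq_nonneg c) hAA,
    trace_smul, Complex.smul_re, htrace, Real.sqrt_sq hc0, smul_eq_mul, sq, ← mul_assoc,
    inv_mul_mul_self]

theorem cfc_sqrt_mul_cfc_sqrt {A : Matrix n n ℂ} (hA : A.PosSemidef) :
    cfc Real.sqrt A * cfc Real.sqrt A = A := by
  have hsa : IsSelfAdjoint A := hA.1.isSelfAdjoint
  have hspec : ∀ x ∈ spectrum ℝ A, 0 ≤ x := by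
    rw [hA.1.spectrum_real_eq_range_eigenvalues]
    exact Set.forall_mem_range.2 hA.eigenvalues_nonneg
  rw [← cfc_mul Real.sqrt Real.sqrt A, cfc_congr fun x hx => Real.mul_self_sqrt (hspec x hx),
    cfc_id' ℝ A]

theorem fidelity_vecMulVec_star {ψ : n → ℂ} (hψ : ‖WithLp.toLp 2 ψ‖ = 1) {ρ : Matrix n n ℂ}
    (hρ : ρ.PosSemidef) :
    fidelity (vecMulVec ψ (star ψ)) ρ = (vecMulVec ψ (star ψ) * ρ).trace.re := by
  set P := vecMulVec ψ (star ψ)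
  set S := cfc Real.sqrt ρ
  have hS : Sᴴ = S := IsSelfAdjoint.cfc
  have hPP : P * P = (1 : ℝ) • P := by
    simp [P, vecMulVec_mul_vecMulVec, star_dotProduct_self_eq_norm_sq, hψ]
  have hsqrtP : cfc Real.sqrt P = P := by
    simpa using cfc_sqrt_of_mul_self_eq_smul (posSemidef_vecMulVec_self_star ψ).1 zero_le_one hPP
  have hPS : P * S = vecMulVec ψ (star (S *ᵥ ψ)) := by
    rw [vecMulVec_mul, star_mulVec, hS]
  have hnorm : ((‖WithLp.toLp 2 (S *ᵥ ψ)‖ ^ 2 : ℝ) : ℂ) = (P * ρ).trace := by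
    rw [← star_dotProduct_self_eq_norm_sq, star_mulVec, hS, ← dotProduct_mulVec, mulVec_mulVec,
      cfc_sqrt_mul_cfc_sqrt hρ, trace_mul_comm, mul_vecMulVec, trace_vecMulVec, dotProduct_comm]
  rw [fidelity, hsqrtP, hPS, traceNorm_vecMulVec_star, hψ, one_mul, ← hnorm, Complex.ofReal_re]

end TraceNorm

section PartialPermutation

variable {ι n : Type*} [Fintype ι] [Fintype n] [DecidableEq n] {e f : ι → n}

theorem conjTranspose_mul_self_sum_single (he : Function.Injective e) :
    (∑ x, Matrix.single (e x) (f x) (1 : ℂ))ᴴ * ∑ x, Matrix.single (e x) (f x) (1 : ℂ) =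
      diagonal (∑ x, Pi.single (f x) 1) := by
  have hdiag : diagonal (∑ x, Pi.single (f x) (1 : ℂ)) =
      ∑ x, Matrix.single (f x) (f x) (1 : ℂ) := by
    simp only [← diagonal_single]
    exact map_sum (diagonalAddMonoidHom n ℂ) _ _
  rw [hdiag, conjTranspose_sum, Finset.sum_mul_sum]
  refine Finset.sum_congr rfl fun x _ => ?_
  rw [Finset.sum_eq_single x _ (by simp)]
  · simp
  · intro y _ hy
    rw [conjTranspose_single, single_mul_single_of_ne _ _ _ _ (he.ne hy.symm)]

open scoped Matrix.Norms.L2Operator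

theorem norm_sum_single_le_one (he : Function.Injective e) (hf : Function.Injective f) :
    ‖∑ x, Matrix.single (e x) (f x) (1 : ℂ)‖ ≤ 1 := by
  have hnorm := l2_opNorm_conjTranspose_mul_self (∑ x, Matrix.single (e x) (f x) (1 : ℂ))
  rw [conjTranspose_mul_self_sum_single he, l2_opNorm_diagonal] at hnorm
  have hentry : ‖(∑ x, Pi.single (f x) 1 : n → ℂ)‖ ≤ 1 := by
    classical
    refine (pi_norm_le_iff_of_nonneg zero_le_one).2 fun a => ?_
    rw [Finset.sum_apply]
    by_cases ha : ∃ y, f y = a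
    · obtain ⟨y, rfl⟩ := ha
      simp [Pi.single_apply, hf.eq_iff]
    · have hzero : ∀ x, (Pi.single (f x) 1 : n → ℂ) a = 0 := fun x =>
        Pi.single_eq_of_ne (fun h => ha ⟨x, h.symm⟩) 1
      simp [hzero]
  rw [hnorm] at hentry
  exact (le_abs_self _).trans (abs_le_one_iff_mul_self_le_one.2 hentry)

end PartialPermutation

section GHZ

variable {k d : ℕ}

/-- The GHZ vector `d^(-1/2) ∑ i, |i, …, i⟩`, whose projection is `ghz k d`. -/
noncomputable def ghzVector (k d : ℕ) : (Fin k → Fin d) → ℂ :=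
  (√(d : ℝ))⁻¹ • ∑ i : Fin d, Pi.single (fun _ => i) 1

theorem ghz_eq_vecMulVec : ghz k d = vecMulVec (ghzVector k d) (star (ghzVector k d)) := by
  have hcoeff : ((√(d : ℝ))⁻¹ * (√(d : ℝ))⁻¹) = 1 / (d : ℝ) := by
    rw [← mul_inv, Real.mul_self_sqrt (Nat.cast_nonneg d), one_div]
  have hvec : vecMulVec (∑ i : Fin d, Pi.single (fun _ : Fin k => i) (1 : ℂ))
      (∑ i : Fin d, Pi.single (fun _ : Fin k => i) 1) =
      ∑ i : Fin d, ∑ j : Fin d, Matrix.single (fun _ => i) (fun _ => j) 1 := by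
    ext a b
    simp only [Matrix.sum_apply, vecMulVec_apply, Finset.sum_apply, Finset.sum_mul_sum]
    refine Finset.sum_congr rfl fun i _ => Finset.sum_congr rfl fun j _ => ?_
    simp only [single_apply, Pi.single_apply, eq_comm (a := a), eq_comm (a := b)]
    split_ifs <;> simp_all
  simp only [ghzVector, star_smul, star_sum, Pi.star_single, star_one, star_trivial,
    smul_vecMulVec, vecMulVec_smul, smul_smul, hcoeff, hvec, ghz]
  ext a b
  simp

theorem posSemidef_ghz : (ghz k d).PosSemidef :=
  ghz_eq_vecMulVec ▸ posSemidef_vecMulVec_self_star _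

theorem trace_ghz (hk : k ≠ 0) (hd : d ≠ 0) : (ghz k d).trace = 1 := by
  have hconst : Function.Injective fun (i : Fin d) (_ : Fin k) => i := fun _ _ h =>
    congrFun h ⟨0, Nat.pos_of_ne_zero hk⟩
  have hdiag : ∀ i j : Fin d, (Matrix.single (fun _ : Fin k => i) (fun _ => j) (1 : ℂ)).trace =
      if i = j then 1 else 0 := by
    intro i j
    split_ifs with hij
    · rw [hij, trace_single_eq_same]
    · exact trace_single_eq_of_ne _ _ _ (hconst.ne hij)
  simp [ghz, trace_smul, trace_sum, hdiag, hd]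

theorem norm_ghzVector (hk : k ≠ 0) (hd : d ≠ 0) : ‖WithLp.toLp 2 (ghzVector k d)‖ = 1 := by
  have htrace := trace_ghz hk hd
  rw [ghz_eq_vecMulVec, trace_vecMulVec, dotProduct_comm, star_dotProduct_self_eq_norm_sq,
    Complex.ofReal_eq_one] at htrace
  exact (pow_eq_one_iff_of_nonneg (norm_nonneg _) two_ne_zero).1 htrace

theorem trace_partialTranspose (S : Finset (Fin k)) (X : Op k d) :
    (partialTranspose S X).trace = X.trace := by
  simp [trace, partialTranspose, Finset.piecewise_same]

theorem trace_partialTranspose_mul (S : Finset (Fin k)) (X Y : Op k d) :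
    (partialTranspose S X * partialTranspose S Y).trace = (X * Y).trace := by
  have hinv : Function.Involutive fun a : (Fin k → Fin d) × (Fin k → Fin d) =>
      (S.piecewise a.2 a.1, S.piecewise a.1 a.2) := by
    rintro ⟨a, b⟩
    ext i <;> by_cases hi : i ∈ S <;> simp [hi]
  simp only [trace, diag_apply, mul_apply, partialTranspose, of_apply]
  rw [← Fintype.sum_prod_type', ← Fintype.sum_prod_type']
  exact Equiv.sum_comp hinv.toPerm fun a => X a.1 a.2 * Y a.2 a.1

theorem partialTranspose_ghz (S : Finset (Fin k)) :
    partialTranspose S (ghz k d) = (1 / (d : ℂ)) • ∑ x : Fin d × Fin d,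
      Matrix.single (S.piecewise (fun _ => x.1) (fun _ => x.2))
        (S.piecewise (fun _ => x.2) (fun _ => x.1)) (1 : ℂ) := by
  ext a b
  simp only [partialTranspose, ghz, of_apply, Matrix.smul_apply, Matrix.sum_apply, single_apply]
  rw [← Fintype.sum_prod_type', ← (Equiv.prodComm (Fin d) (Fin d)).sum_comp]
  congr 1
  refine Finset.sum_congr rfl fun x _ => if_congr ?_ rfl rfl
  simp only [funext_iff, Equiv.prodComm_apply, Prod.fst_swap, Prod.snd_swap, ← forall_and]
  refine forall_congr' fun i => ?_
  by_cases hi : i ∈ S <;> simp [hi, and_comm]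

theorem piecewise_const_injective {S : Finset (Fin k)} {i j : Fin k} (hi : i ∈ S) (hj : j ∉ S) :
    Function.Injective fun x : Fin d × Fin d =>
      (S.piecewise (fun _ => x.1) (fun _ => x.2) : Fin k → Fin d) := by
  intro x y h
  exact Prod.ext (by simpa [hi] using congrFun h i) (by simpa [hj] using congrFun h j)

open scoped Matrix.Norms.L2Operator in
theorem norm_trace_ghz_mul_le (m : Bipartition k) (X : Op k d) :
    ‖(ghz k d * X).trace‖ ≤ 1 / (d : ℝ) * traceNorm (partialTranspose m.1 X) := by
  obtain ⟨S, ⟨i, hi⟩, hS⟩ := m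
  have h0 : (⟨0, i.pos⟩ : Fin k) ∉ S := fun h => hS _ h rfl
  have he := piecewise_const_injective (d := d) hi h0
  have hV := norm_sum_single_le_one he (he.comp Prod.swap_injective)
  rw [← trace_partialTranspose_mul S, partialTranspose_ghz, smul_mul_assoc, trace_smul, norm_smul,
    norm_div, norm_one, Complex.norm_natCast]
  refine mul_le_mul_of_nonneg_left ((norm_trace_mul_le _ _).trans ?_) (by positivity)
  exact mul_le_of_le_one_left ((norm_nonneg _).trans (norm_trace_le_traceNorm _)) hV

theorem one_le_traceNorm_partialTranspose (S : Finset (Fin k)) {ω : Op k d} (hω : IsState ω) :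
    1 ≤ traceNorm (partialTranspose S ω) := by
  simpa only [trace_partialTranspose, hω.2, norm_one] using
    norm_trace_le_traceNorm (partialTranspose S ω)

theorem trace_ghz_mul_sum_le {q : Bipartition k → ℝ} (hq : ∀ m, 0 ≤ q m)
    (t : Bipartition k → Op k d) :
    (ghz k d * ∑ m, q m • t m).trace.re ≤
      1 / (d : ℝ) * ∑ m, q m * traceNorm (partialTranspose m.1 (t m)) := by
  rw [Finset.mul_sum, trace_sum, Complex.re_sum, Finset.mul_sum]
  refine Finset.sum_le_sum fun m _ => ?_
  rw [mul_smul_comm, trace_smul, Complex.smul_re, smul_eq_mul, mul_left_comm]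
  exact mul_le_mul_of_nonneg_left
    ((Complex.re_le_norm _).trans (norm_trace_ghz_mul_le m (t m))) (hq m)

end GHZ

section BinaryRelEntropy

variable {F u s N : ℝ}

theorem binary_likelihoodRatio_le (hu : 0 < u) (huF : u ≤ F) (hF1 : F ≤ 1) (hN : 1 ≤ N)
    (hsN : s ≤ u * N) : F * (s / u) + (1 - F) * ((1 - s) / (1 - u)) ≤ N := by
  rcases (huF.trans hF1).eq_or_lt with rfl | hu1
  · obtain rfl : F = 1 := hF1.antisymm huF
    simpa using hsN
  have hu1' : 0 < 1 - u := sub_pos.2 hu1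
  calc F * (s / u) + (1 - F) * ((1 - s) / (1 - u))
      = (s * (F - u) + u * (1 - F)) / (u * (1 - u)) := by field_simp; ring
    _ ≤ (u * N * (F - u) + u * N * (1 - F)) / (u * (1 - u)) := by
      refine div_le_div_of_nonneg_right (add_le_add ?_ ?_) (mul_pos hu hu1').le
      · exact mul_le_mul_of_nonneg_right hsN (sub_nonneg.2 huF)
      · exact mul_le_mul_of_nonneg_right (le_mul_of_one_le_right hu.le hN) (sub_nonneg.2 hF1)
    _ = N := by field_simp; ring

theorem classicalRelEntropy_binary_le_add_logb (hu : 0 < u) (huF : u ≤ F) (hF1 : F ≤ 1)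
    (hs0 : 0 ≤ s) (hs1 : s ≤ 1) (hN : 1 ≤ N) (hsN : s ≤ u * N) :
    classicalRelEntropy ![F, 1 - F] ![u, 1 - u] ≤
      classicalRelEntropy ![F, 1 - F] ![s, 1 - s] + (Real.logb 2 N : ℝ) := by
  have hF : 0 ≤ F := hu.le.trans huF
  refine classicalRelEntropy_le_add_logb ?_ ?_ ?_ ?_ ?_ ?_
  · simpa [Fin.forall_fin_two] using ⟨hF, hF1⟩
  · simp
  · simpa [Fin.forall_fin_two] using ⟨hu.le, huF.trans hF1⟩
  · simpa [Fin.forall_fin_two] using ⟨hs0, hs1⟩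
  · intro x hx
    fin_cases x
    · simpa using hu.ne'
    · have hFlt : F < 1 := hF1.lt_of_ne fun h => hx (by simp [h])
      simpa using (sub_pos.2 (huF.trans_lt hFlt)).ne'
  · simpa using binary_likelihoodRatio_le hu huF hF1 hN hsN

theorem mul_logb_inv_sub_binaryEntropy_le (hu : 0 < u) (hu1 : u ≤ 1) (hF : 0 ≤ F)
    (hF1 : F ≤ 1) :
    ((F * Real.logb 2 u⁻¹ - binaryEntropy F : ℝ) : EReal) ≤
      classicalRelEntropy ![F, 1 - F] ![u, 1 - u] := by
  have hsupp : Function.support ![F, 1 - F] ⊆ Function.support ![u, 1] := by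
    intro x _
    fin_cases x <;> simp [hu.ne']
  have hle : classicalRelEntropy ![F, 1 - F] ![u, 1] ≤
      classicalRelEntropy ![F, 1 - F] ![u, 1 - u] + (Real.logb 2 1 : ℝ) := by
    refine classicalRelEntropy_le_add_logb ?_ ?_ ?_ ?_ hsupp ?_
    · simpa [Fin.forall_fin_two] using ⟨hF, hF1⟩
    · simp
    · simpa [Fin.forall_fin_two] using hu.le
    · simpa [Fin.forall_fin_two] using ⟨hu.le, hu1⟩
    · simpa [Fin.sum_univ_two, hu.ne'] using le_sub_iff_add_le'.1
        (mul_le_of_le_one_right (sub_nonneg.2 hF1) (sub_le_self 1 hu.le))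
  rw [Real.logb_one, EReal.coe_zero, add_zero] at hle
  refine le_trans (le_of_eq ?_) hle
  rw [classicalRelEntropy, if_pos hsupp, EReal.coe_eq_coe_iff, Fin.sum_univ_two]
  have hlog : F * Real.logb 2 (F / u) = F * Real.logb 2 F + F * Real.logb 2 u⁻¹ := by
    rcases eq_or_ne F 0 with rfl | hF0
    · simp
    · rw [div_eq_mul_inv, Real.logb_mul hF0 (inv_ne_zero hu.ne'), mul_add]
  simp only [cons_val_zero, cons_val_one, div_one, hlog, binaryEntropy]
  ring

end BinaryRelEntropy

section Rains

variable {k d : ℕ}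

theorem isState_sum_smul {ι n : Type*} [Fintype ι] [Fintype n] {r : ι → ℝ} {ω : ι → Matrix n n ℂ}
    (hr : ∀ i, 0 ≤ r i) (hr1 : ∑ i, r i = 1) (hω : ∀ i, IsState (ω i)) :
    IsState (∑ i, r i • ω i) := by
  refine ⟨posSemidef_sum _ fun i _ => (hω i).1.smul (hr i), ?_⟩
  simp only [trace_sum, trace_smul, (hω _).2, ← Finset.sum_smul, hr1, one_smul]

theorem ghz_mul_self (hk : k ≠ 0) (hd : d ≠ 0) : ghz k d * ghz k d = ghz k d := by
  simp [ghz_eq_vecMulVec, vecMulVec_mul_vecMulVec, star_dotProduct_self_eq_norm_sq,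
    norm_ghzVector hk hd]

theorem posSemidef_one_sub_ghz (hk : k ≠ 0) (hd : d ≠ 0) : (1 - ghz k d).PosSemidef := by
  have hsq : (1 - ghz k d)ᴴ * (1 - ghz k d) = 1 - ghz k d := by
    simp [posSemidef_ghz.1.eq, mul_sub, sub_mul, ghz_mul_self hk hd]
  exact hsq ▸ posSemidef_conjTranspose_mul_self _

theorem isPOVM_ghz (hk : k ≠ 0) (hd : d ≠ 0) : IsPOVM ![ghz k d, 1 - ghz k d] where
  posSemidef := by simpa [Fin.forall_fin_two] using ⟨posSemidef_ghz, posSemidef_one_sub_ghz hk hd⟩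
  sum_eq_one := by simp

theorem trace_one_sub_ghz_mul {ρ : Op k d} (hρ : ρ.trace = 1) :
    ((1 - ghz k d) * ρ).trace.re = 1 - (ghz k d * ρ).trace.re := by
  rw [sub_mul, one_mul, trace_sub, hρ, Complex.sub_re, Complex.one_re]

theorem fidelity_ghz (hk : k ≠ 0) (hd : d ≠ 0) {ρ : Op k d} (hρ : ρ.PosSemidef) :
    fidelity (ghz k d) ρ = (ghz k d * ρ).trace.re := by
  rw [ghz_eq_vecMulVec, fidelity_vecMulVec_star (norm_ghzVector hk hd) hρ]

theorem fidelity_ghz_mem_Icc (hk : k ≠ 0) (hd : d ≠ 0) {ρ : Op k d} (hρ : IsState ρ) :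
    fidelity (ghz k d) ρ ∈ Set.Icc 0 1 := by
  rw [fidelity_ghz hk hd hρ.1]
  refine ⟨re_trace_mul_nonneg posSemidef_ghz hρ.1, ?_⟩
  rw [← sub_nonneg, ← trace_one_sub_ghz_mul hρ.2]
  exact re_trace_mul_nonneg (posSemidef_one_sub_ghz hk hd) hρ.1

theorem classicalRelEntropy_fidelity_ghz_le (hk : k ≠ 0) (hd : d ≠ 0) {ρ σ : Op k d}
    (hρ : IsState ρ) (hσ : IsState σ) :
    classicalRelEntropy ![fidelity (ghz k d) ρ, 1 - fidelity (ghz k d) ρ]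
      ![fidelity (ghz k d) σ, 1 - fidelity (ghz k d) σ] ≤ quantumRelEntropy ρ σ := by
  have hmeasure : ∀ τ : Op k d, IsState τ →
      (fun x => (![ghz k d, 1 - ghz k d] x * τ).trace.re) =
        ![fidelity (ghz k d) τ, 1 - fidelity (ghz k d) τ] := by
    intro τ hτ
    ext x
    fin_cases x
    · exact (fidelity_ghz hk hd hτ.1).symm
    · exact (trace_one_sub_ghz_mul hτ.2).trans (by rw [fidelity_ghz hk hd hτ.1]; rfl)
  rw [← hmeasure ρ hρ, ← hmeasure σ hσ]
  exact (isPOVM_ghz hk hd).classicalRelEntropy_le hρ.1 hσ.1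

theorem classicalRelEntropy_fidelity_ghz_le_gmre (hk : k ≠ 0) (hd : d ≠ 0) {ρ : Op k d}
    (hρ : IsState ρ) (hF : 1 / (d : ℝ) ≤ fidelity (ghz k d) ρ) :
    classicalRelEntropy ![fidelity (ghz k d) ρ, 1 - fidelity (ghz k d) ρ]
      ![1 / (d : ℝ), 1 - 1 / (d : ℝ)] ≤ gmre ρ := by
  refine le_sInf ?_
  rintro x ⟨r, ω, hr, hr1, hω, rfl⟩
  set σ := ∑ m, r m • ω m
  set N := ∑ m, r m * traceNorm (partialTranspose m.1 (ω m))
  have hσ : IsState σ := isState_sum_smul hr hr1 hω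
  have hσF := fidelity_ghz_mem_Icc hk hd hσ
  have hu : 0 < 1 / (d : ℝ) := by positivity
  have hN : 1 ≤ N := hr1.ge.trans <| Finset.sum_le_sum fun m _ =>
    le_mul_of_one_le_right (hr m) (one_le_traceNorm_partialTranspose m.1 (hω m))
  have hσN : fidelity (ghz k d) σ ≤ 1 / (d : ℝ) * N := by
    rw [fidelity_ghz hk hd hσ.1]
    exact trace_ghz_mul_sum_le hr ω
  refine (classicalRelEntropy_binary_le_add_logb hu hF (fidelity_ghz_mem_Icc hk hd hρ).2
    hσF.1 hσF.2 hN hσN).trans ?_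
  exact add_le_add_left (classicalRelEntropy_fidelity_ghz_le hk hd hρ hσ) _

end Rains

end GMRE

open GMRE in
theorem lemma1 (k d : ℕ) (hk : 2 ≤ k) (hd : 1 ≤ d) :
    (∀ ρ : GMRE.Op k d, GMRE.IsState ρ →
      ∀ F : ℝ, F = GMRE.fidelity (GMRE.ghz k d) ρ → 1 / (d : ℝ) ≤ F →
        GMRE.classicalRelEntropy ![F, 1 - F] ![1 / (d : ℝ), 1 - 1 / (d : ℝ)] ≤ GMRE.gmre ρ ∧
        ((F * Real.logb 2 d - GMRE.binaryEntropy F : ℝ) : EReal) ≤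
          GMRE.classicalRelEntropy ![F, 1 - F] ![1 / (d : ℝ), 1 - 1 / (d : ℝ)]) ∧
    (∀ σ ∈ GMRE.setT k d, (GMRE.ghz k d * σ).trace.re ≤ 1 / (d : ℝ)) := by
  have hk0 : k ≠ 0 := by lia
  have hd0 : d ≠ 0 := by lia
  have hu : 0 < 1 / (d : ℝ) := by positivity
  constructor
  · rintro ρ hρ F rfl hF
    have hF1 := (fidelity_ghz_mem_Icc hk0 hd0 hρ).2
    refine ⟨classicalRelEntropy_fidelity_ghz_le_gmre hk0 hd0 hρ hF, ?_⟩
    simpa only [one_div, inv_inv] using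
      mul_logb_inv_sub_binaryEntropy_le hu (hF.trans hF1) (hu.le.trans hF) hF1
  · rintro σ ⟨q, t, hq, -, rfl, hqt⟩
    exact (trace_ghz_mul_sum_le hq t).trans (mul_le_of_le_one_right hu.le hqt)
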